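/- Let $d\ge 0$, and let either $\Omega=\mathbb R^d$ with dominating measure $\nu$ the Lebesgue measure, or $\Omega\subseteq\mathbb R^d$ countable with $\nu$ the counting measure on $\Omega$. Let $\mathcal P(\Omega)$ be the set of probability measures on $\Omega$ that are absolutely continuous with respect to $\nu$. For $P\in\mathcal P(\Omega)$ let $\Omega_P$ be the support of $P$, i.e. the smallest closed set of full measure, where $\mathbb R^d$ has its usual topology in the first case and $\Omega$ has the discrete topology in the second (so in the second case $\Omega_P=\{y\in\Omega: P(\{y\})>0\}$), and let $\Omega_P^{cc}=\operatorname{cl}(\operatorname{conv}\Omega_P)$ be the convex support of $P$. Put $$\Theta_P=\Big\{\theta\in\mathbb R^d:\int_\Omega e^{\langle y,\theta\rangle}\,dP(y)<\infty\Big\},\qquad \psi_P(\theta)=\log\int_\Omega e^{\langle y,\theta\rangle}\,dP(y)\ \ (\theta\in\Theta_P),\qquad \psi_P(\theta)=+\infty\ \ (\theta\notin\Theta_P).$$ Let $$\psi_P^*(y)=\sup_{\theta\in\mathbb R^d}\{\langle y,\theta\rangle-\psi_P(\theta)\},\qquad \kappa_P(y)=\inf\{\mathrm{KL}(Q\,|\,P):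 Q\in\mathcal P(\Omega),\ \mathbb E_Q=y\}$$ be the Cramér rate function and the MEM (maximum entropy on the mean) function, where $\mathrm{KL}$ is the Kullback–Leibler divergence, $\mathbb E_Q=y$ includes that the expected value of $Q$ exists, and $\inf\emptyset=+\infty$. For $f:\mathbb R^d\to[-\infty,\infty]$ write $\operatorname{dom}f=\{y: f(y)<\infty\}$. Assume that $P\in\mathcal P(\Omega)$ generates a minimal and steep exponential family, that is, $\dim\Theta_P=\dim\Omega_P^{cc}=d$ (dimensions of affine hulls), and $\psi_P$ is essentially smooth: $\operatorname{int}\Theta_P\neq\emptyset$, $\psi_P$ is differentiable on $\operatorname{int}\Theta_P$, and $\|\nabla\psi_P(\theta_k)\|\to\infty$ for every sequence $\theta_k\in\operatorname{int}\Theta_P$ that converges to a boundary point of $\Theta_P$. Assume moreover that $0\in\operatorname{int}\Theta_P$. Then: (a) If $\Omega_P$ is countable and $\operatorname{conv}\Omega_P$ is closed (i.e. $\operatorname{conv}\Omega_P=\Omega_P^{cc}$), then $\operatorname{dom}\kappa_P=\operatorname{dom}\psi_P^*=\Omega_P^{cc}$. In particular, $\operatorname{dom}\kappa_P=\operatorname{dom}\psi_P^*=\Omega_P^{cc}$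 if $\Omega_P$ is finite. (b) If $\Omega_P$ is uncountable, then $\operatorname{dom}\kappa_P=\operatorname{dom}\psi_P^*=\operatorname{int}\Omega_P^{cc}$. -/

import Mathlib

open MeasureTheory Filter Topology

noncomputable section

namespace MaxEntMean

/-- The Euclidean space `ℝ^d`. -/
abbrev E (d : ℕ) : Type := EuclideanSpace ℝ (Fin d)

/-! ### Convex analysis -/

/-- Effective domain of an extended-real-valued function. -/
def dom {d : ℕ} (f : E d → EReal) : Set (E d) := {x | f x < ⊤}

/-- Fenchel conjugate `f^*(y) = sup_x (⟪y, x⟫ - f x)`. -/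
def conjugate {d : ℕ} (f : E d → EReal) (y : E d) : EReal :=
  ⨆ x : E d, ((inner ℝ y x : ℝ) : EReal) - f x

/-- Essential smoothness of a (proper convex) function `f : ℝ^d → (-∞, ∞]`. On `dom f` such an `f`
is finite, so differentiability and gradient are those of the real-valued function `toReal ∘ f`
at interior points of `dom f`. -/
structure IsEssentiallySmooth {d : ℕ} (f : E d → EReal) : Prop where
  interior_nonempty : (interior (dom f)).Nonempty
  differentiable : ∀ x ∈ interior (dom f), DifferentiableAt ℝ (fun z => (f z).toReal) x
  steep : ∀ (x : ℕ → E d) (a : E d), (∀ k, x k ∈ interior (dom f)) → a ∈ frontier (dom f) →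
    Tendsto x atTop (𝓝 a) →
    Tendsto (fun k => ‖gradient (fun z => (f z).toReal) (x k)‖) atTop atTop

/-- Dimension of a (nonempty convex) set: the dimension of its affine hull. -/
def affineDim {d : ℕ} (A : Set (E d)) : ℕ := Module.finrank ℝ (vectorSpan ℝ A)

/-! ### Sample spaces and distributions -/

/-- The two scenarios for the sample space `Ω` with its dominating measure: either all of `ℝ^d`
with Lebesgue measure, or a countable subset of `ℝ^d` with counting measure. Measures on `Ω` are
represented by Borel measures on `ℝ^d` that give no mass to the complement of `Ω`. -/
inductive SampleSpace (d : ℕ) : Type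
  | continuous : SampleSpace d
  | discrete (Ω : Set (E d)) (hΩ : Ω.Countable) : SampleSpace d

/-- The dominating measure. -/
def SampleSpace.dominating {d : ℕ} : SampleSpace d → Measure (E d)
  | .continuous => volume
  | .discrete Ω _ => Measure.count.restrict Ω

/-- The probability measures on `Ω` that are absolutely continuous with respect to the dominating
measure. -/
def SampleSpace.distributions {d : ℕ} (S : SampleSpace d) : Set (Measure (E d)) :=
  {P | IsProbabilityMeasure P ∧ P ≪ S.dominating}

/-- The support of a distribution: the least closed set of full measure, where `ℝ^d` carries its
usual topology and a countable `Ω` carries the discrete one (so that in the second case the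
support is the set of atoms); see `isLeast_support_continuous`, `isLeast_support_discrete`. -/
def SampleSpace.support {d : ℕ} : SampleSpace d → Measure (E d) → Set (E d)
  | .continuous, P => P.support
  | .discrete Ω _, P => {y | y ∈ Ω ∧ P {y} ≠ 0}

theorem SampleSpace.isLeast_support_continuous {d : ℕ} (P : Measure (E d)) :
    IsLeast {A : Set (E d) | IsClosed A ∧ P Aᶜ = 0}
      ((SampleSpace.continuous : SampleSpace d).support P) := by
  refine ⟨⟨Measure.isClosed_support, Measure.measure_compl_support⟩, ?_⟩
  rintro A ⟨hA, h0⟩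
  exact Measure.support_subset_of_isClosed hA (by simpa [mem_ae_iff] using h0)

theorem SampleSpace.isLeast_support_discrete {d : ℕ} (Ω : Set (E d)) (hΩ : Ω.Countable)
    (P : Measure (E d)) (_hP : P ∈ (SampleSpace.discrete Ω hΩ).distributions) :
    IsLeast {A : Set (E d) | A ⊆ Ω ∧ P (Ω \ A) = 0}
      ((SampleSpace.discrete Ω hΩ).support P) := by
  refine ⟨⟨fun y hy => hy.1, ?_⟩, ?_⟩
  · refine (measure_null_iff_singleton (hΩ.mono Set.sdiff_subset)).2 ?_
    intro y hy
    by_contra h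
    exact hy.2 ⟨hy.1, h⟩
  · rintro A ⟨_, h0⟩ y ⟨hy, hpos⟩
    by_contra h
    have hsub : {y} ⊆ Ω \ A := by
      rintro z rfl
      exact ⟨hy, h⟩
    exact hpos (measure_mono_null hsub h0)

/-- The convex support: closure of the convex hull of the support. -/
def SampleSpace.convexSupport {d : ℕ} (S : SampleSpace d) (P : Measure (E d)) : Set (E d) :=
  closure (convexHull ℝ (S.support P))

/-! ### Exponential families -/

/-- The natural parameter space `Θ_P`. -/
def naturalParameters {d : ℕ} (P : Measure (E d)) : Set (E d) :=
  {θ | Integrable (fun y : E d => Real.exp (inner ℝ y θ)) P}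

open Classical in
/-- The log-normalizer (cumulant generating function) `ψ_P`. -/
def logNormalizer {d : ℕ} (P : Measure (E d)) (θ : E d) : EReal :=
  if θ ∈ naturalParameters P then
    ((Real.log (∫ y, Real.exp (inner ℝ y θ) ∂P) : ℝ) : EReal)
  else ⊤

/-- Minimality of the exponential family generated by `P`:
`dim Θ_P = dim (convex support of P) = d`. -/
def SampleSpace.IsMinimal {d : ℕ} (S : SampleSpace d) (P : Measure (E d)) : Prop :=
  affineDim (naturalParameters P) = d ∧ affineDim (S.convexSupport P) = d

/-- Steepness of the exponential family generated by `P`. -/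
def IsSteep {d : ℕ} (P : Measure (E d)) : Prop := IsEssentiallySmooth (logNormalizer P)

/-! ### The two functions -/

/-- The Cramér rate function `ψ_P^*`. -/
def cramerRate {d : ℕ} (P : Measure (E d)) : E d → EReal := conjugate (logNormalizer P)

/-- The maximum-entropy-on-the-mean function
`κ_P(y) = inf {KL(Q | P) : Q a distribution on Ω whose expected value exists and equals y}`.
The infimum over the empty family is `⊤`. -/
def SampleSpace.memFunction {d : ℕ} (S : SampleSpace d) (P : Measure (E d)) (y : E d) : EReal :=
  ⨅ Q ∈ {Q : Measure (E d) | Q ∈ S.distributions ∧ Integrable (fun z : E d => z) Q ∧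
      ∫ z, z ∂Q = y},
    ((InformationTheory.klDiv Q P : ENNReal) : EReal)

end MaxEntMean

end

open MeasureTheory Filter Topology InformationTheory
open scoped ENNReal NNReal

namespace MaxEntMean

/-! Let M be `boundedDensityMeans P`. The proof rests on the chain M ⊆ dom κ_P ⊆ dom ψ_P^* ⊆ Ω_P^cc.
A density bounded with respect to P has finite divergence, which gives the first inclusion. The
Donsker–Varadhan inequality gives ψ_P^* ≤ κ_P wherever κ_P is finite, hence the second. The third is
separation: if ⟨z, θ⟩ < ⟨y, θ⟩ for P-almost every z, then ψ_P^*(y) = ∞ (`cramerRate_eq_top`).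

M is convex, so both cases reduce to finding enough points of M. If the support is countable, its
points are atoms and lie in M; hence M contains conv Ω_P, and the chain closes when this hull is
closed. If it is uncountable, P is absolutely continuous with respect to Lebesgue measure.
Conditioning P on small balls shows that M is dense in the support, and a convex set contains the
interior of its closure, so M contains int Ω_P^cc. Conversely, a supporting hyperplane is a null
set, so separation is strict almost everywhere even at boundary points, and these leave dom ψ_P^*.
-/

/-- The means of the probability measures with bounded density with respect to `P`. -/
def boundedDensityMeans {d : ℕ} (P : Measure (E d)) : Set (E d) :=
  {y | ∃ Q : Measure (E d), IsProbabilityMeasure Q ∧ (∃ c : ℝ≥0, Q ≤ c • P) ∧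
    Integrable (fun z : E d => z) Q ∧ ∫ z, z ∂Q = y}

/-! ### Measures with bounded density -/

theorem smul_measure_mono {α : Type*} [MeasurableSpace α] {μ ν : Measure α} (c : ℝ≥0∞)
    (h : μ ≤ ν) : c • μ ≤ c • ν :=
  Measure.le_iff'.2 fun s => mul_le_mul_right (h s) c

/-- The density takes values in [0, c] almost everywhere, and there log t ≤ t - 1 gives `klFun t` ≤
(t - 1)² ≤ c² + 1. -/
theorem klDiv_ne_top_of_le_smul {α : Type*} [MeasurableSpace α] {Q P : Measure α}
    [IsFiniteMeasure Q] [IsFiniteMeasure P] {c : ℝ≥0} (h : Q ≤ c • P) : klDiv Q P ≠ ∞ := by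
  have hac : Q ≪ P :=
    (Measure.absolutelyContinuous_of_le h).trans Measure.smul_absolutelyContinuous
  rw [klDiv_eq_lintegral_klFun_of_ac hac]
  have hle : Q.rnDeriv P ≤ᵐ[P] fun _ => (c : ℝ≥0∞) := by
    refine ae_le_of_forall_setLIntegral_le_of_sigmaFinite (Q.measurable_rnDeriv P) fun s _ _ => ?_
    refine (Measure.setLIntegral_rnDeriv_le s).trans ((h s).trans ?_)
    rw [setLIntegral_const]
    rfl
  have hb : ∫⁻ x, ENNReal.ofReal (klFun (Q.rnDeriv P x).toReal) ∂P
      ≤ ∫⁻ _, ENNReal.ofReal ((c : ℝ) ^ 2 + 1) ∂P := by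
    refine lintegral_mono_ae ?_
    filter_upwards [hle] with x hx
    refine ENNReal.ofReal_le_ofReal ?_
    have h0 : 0 ≤ (Q.rnDeriv P x).toReal := ENNReal.toReal_nonneg
    have h1 : (Q.rnDeriv P x).toReal ≤ c := ENNReal.toReal_mono ENNReal.coe_ne_top hx
    generalize (Q.rnDeriv P x).toReal = t at h0 h1
    rcases h0.eq_or_lt with rfl | hpos
    · simp only [klFun_zero]
      nlinarith
    · rw [klFun]
      have := mul_le_mul_of_nonneg_left (Real.log_le_sub_one_of_pos hpos) h0
      nlinarith
  refine (hb.trans_lt ?_).ne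
  rw [lintegral_const]
  exact ENNReal.mul_lt_top ENNReal.ofReal_lt_top (measure_lt_top _ _)

variable {d : ℕ}

theorem convex_boundedDensityMeans (P : Measure (E d)) : Convex ℝ (boundedDensityMeans P) := by
  rintro _ ⟨Q₁, hQ₁, ⟨c₁, hc₁⟩, hi₁, rfl⟩ _ ⟨Q₂, hQ₂, ⟨c₂, hc₂⟩, hi₂, rfl⟩ a b ha hb hab
  have j₁ : Integrable (fun z : E d => z) (ENNReal.ofReal a • Q₁) :=
    hi₁.smul_measure ENNReal.ofReal_ne_top
  have j₂ : Integrable (fun z : E d => z) (ENNReal.ofReal b • Q₂) :=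
    hi₂.smul_measure ENNReal.ofReal_ne_top
  refine ⟨ENNReal.ofReal a • Q₁ + ENNReal.ofReal b • Q₂, ⟨?_⟩,
    ⟨a.toNNReal * c₁ + b.toNNReal * c₂, ?_⟩, j₁.add_measure j₂, ?_⟩
  · simp [← ENNReal.ofReal_add ha hb, hab]
  · rw [add_smul, mul_smul, mul_smul]
    exact add_le_add (smul_measure_mono _ hc₁) (smul_measure_mono _ hc₂)
  · rw [integral_add_measure j₁ j₂, integral_smul_measure, integral_smul_measure,
      ENNReal.toReal_ofReal ha, ENNReal.toReal_ofReal hb]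

theorem cond_le_smul {α : Type*} [MeasurableSpace α] (P : Measure α) {s : Set α}
    (h : P s ≠ 0) : ProbabilityTheory.cond P s ≤ ((P s)⁻¹).toNNReal • P := by
  have : (((P s)⁻¹).toNNReal : ℝ≥0∞) = (P s)⁻¹ := ENNReal.coe_toNNReal (ENNReal.inv_ne_top.2 h)
  rw [ProbabilityTheory.cond, ← this]
  exact smul_measure_mono _ Measure.restrict_le_self

/-- Conditioning P on the ball gives density at most the inverse mass of the ball, and the mean
stays in the ball by convexity. -/
theorem exists_mem_boundedDensityMeans_closedBall {P : Measure (E d)} [IsFiniteMeasure P]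
    {y : E d} {r : ℝ} (h : P (Metric.closedBall y r) ≠ 0) :
    ∃ x ∈ boundedDensityMeans P, x ∈ Metric.closedBall y r := by
  have hp := ProbabilityTheory.cond_isProbabilityMeasure h
  have hmem : ∀ᵐ z ∂(ProbabilityTheory.cond P (Metric.closedBall y r)),
      z ∈ Metric.closedBall y r :=
    ProbabilityTheory.ae_cond_mem Metric.isClosed_closedBall.measurableSet
  have hint : Integrable (fun z : E d => z)
      (ProbabilityTheory.cond P (Metric.closedBall y r)) := by
    refine Integrable.of_bound measurable_id.aestronglyMeasurable (‖y‖ + r) ?_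
    filter_upwards [hmem] with z hz
    have h1 : ‖z - y‖ ≤ r := by simpa [dist_eq_norm] using hz
    have h2 := norm_add_le (z - y) y
    rw [sub_add_cancel] at h2
    linarith
  exact ⟨_, ⟨_, hp, ⟨_, cond_le_smul P h⟩, hint, rfl⟩,
    (convex_closedBall y r).integral_mem Metric.isClosed_closedBall hmem hint⟩

theorem mem_boundedDensityMeans_of_atom {P : Measure (E d)} [IsFiniteMeasure P]
    {y : E d} (h : P {y} ≠ 0) : y ∈ boundedDensityMeans P := by
  -- An atom is a closed ball of radius zero with positive mass.
  rw [← Metric.closedBall_zero] at h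
  obtain ⟨x, hx, hxy⟩ := exists_mem_boundedDensityMeans_closedBall h
  rw [Metric.closedBall_zero, Set.mem_singleton_iff] at hxy
  exact hxy ▸ hx

theorem support_subset_closure_boundedDensityMeans (P : Measure (E d)) [IsFiniteMeasure P] :
    P.support ⊆ closure (boundedDensityMeans P) := by
  intro y hy
  refine Metric.mem_closure_iff.2 fun ε hε => ?_
  have := (Measure.mem_support_iff_forall y).1 hy _ (Metric.closedBall_mem_nhds y (half_pos hε))
  obtain ⟨x, hx, hxy⟩ := exists_mem_boundedDensityMeans_closedBall this.ne'
  refine ⟨x, hx, ?_⟩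
  rw [Metric.mem_closedBall, dist_comm] at hxy
  linarith

/-- Affine spans are closed in finite dimension, so if the closure has an interior point, then A
spans the space and itself has nonempty interior. -/
theorem _root_.Convex.interior_closure_subset {A : Set (E d)} (hA : Convex ℝ A) :
    interior (closure A) ⊆ A := by
  intro x hx
  have hspan : affineSpan ℝ A = ⊤ := by
    have hcl : IsClosed (affineSpan ℝ A : Set (E d)) :=
      AffineSubspace.closed_of_finiteDimensional _
    have hsub : closure A ⊆ affineSpan ℝ A := closure_minimal (subset_affineSpan ℝ A) hcl
    have := isOpen_interior.affineSpan_eq_top ⟨x, hx⟩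
    rw [eq_top_iff, ← this, affineSpan_le]
    exact interior_subset.trans hsub
  have hne := hA.interior_nonempty_iff_affineSpan_eq_top.2 hspan
  rw [hA.interior_closure_eq_interior_of_nonempty_interior hne] at hx
  exact interior_subset hx

theorem boundedDensityMeans_subset_dom_memFunction (S : SampleSpace d) {P : Measure (E d)}
    (hP : P ∈ S.distributions) : boundedDensityMeans P ⊆ dom (S.memFunction P) := by
  rintro y ⟨Q, hQ, ⟨c, hc⟩, hi, hy⟩
  have := hP.1
  have hac : Q ≪ P :=
    (Measure.absolutelyContinuous_of_le hc).trans Measure.smul_absolutelyContinuous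
  have hmem : Q ∈ {Q : Measure (E d) | Q ∈ S.distributions ∧ Integrable (fun z : E d => z) Q ∧
      ∫ z, z ∂Q = y} := ⟨⟨hQ, hac.trans hP.2⟩, hi, hy⟩
  have hle : S.memFunction P y ≤ ((klDiv Q P : ℝ≥0∞) : EReal) := iInf₂_le Q hmem
  refine hle.trans_lt ?_
  rw [lt_top_iff_ne_top, Ne, EReal.coe_ennreal_eq_top_iff]
  exact klDiv_ne_top_of_le_smul hc

/-! ### Upper bounds on the domains -/

/-- The Donsker–Varadhan inequality for a linear functional. -/
theorem inner_integral_sub_log_le_toReal_klDiv {P Q : Measure (E d)} [IsProbabilityMeasure P]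
    [IsProbabilityMeasure Q] (hKL : klDiv Q P ≠ ∞) (hi : Integrable (fun z : E d => z) Q)
    {θ : E d} (hθ : θ ∈ naturalParameters P) :
    inner ℝ (∫ z, z ∂Q) θ - Real.log (∫ z, Real.exp (inner ℝ z θ) ∂P) ≤ (klDiv Q P).toReal := by
  obtain ⟨hac, hllr⟩ := klDiv_ne_top_iff.1 hKL
  have hθ' : Integrable (fun y : E d => Real.exp (inner ℝ y θ)) P := hθ
  have hlin : Integrable (fun z : E d => (inner ℝ z θ : ℝ)) Q := hi.inner_const θ
  have hmean : ∫ z, (inner ℝ z θ : ℝ) ∂Q = inner ℝ (∫ z, z ∂Q) θ := by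
    rw [real_inner_comm, ← integral_inner hi θ]
    simp_rw [real_inner_comm]
  have := isProbabilityMeasure_tilted hθ'
  -- The inequality is the nonnegativity of the divergence of Q from the exponential tilt of P by θ.
  have h0 := integral_llr_add_sub_measure_univ_nonneg
    (hac.trans (absolutelyContinuous_tilted hθ'))
    (integrable_llr_tilted_right hac hlin hllr hθ')
  rw [integral_llr_tilted_right hac hlin hθ' hllr, hmean] at h0
  rw [toReal_klDiv_of_measure_eq hac (by simp)]
  simp only [probReal_univ] at h0
  linarith

theorem dom_memFunction_subset_dom_cramerRate (S : SampleSpace d) {P : Measure (E d)}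
    (hP : P ∈ S.distributions) : dom (S.memFunction P) ⊆ dom (cramerRate P) := by
  intro y hy
  simp only [dom, Set.mem_ofPred_eq, SampleSpace.memFunction, iInf_lt_iff] at hy
  obtain ⟨Q, ⟨hQ, hi, rfl⟩, hlt⟩ := hy
  have := hP.1
  have := hQ.1
  have hKL : klDiv Q P ≠ ∞ := by
    rintro h
    simp [h] at hlt
  refine lt_of_le_of_lt (iSup_le fun θ => ?_) (EReal.coe_lt_top (klDiv Q P).toReal)
  by_cases hθ : θ ∈ naturalParameters P
  · rw [logNormalizer, if_pos hθ, ← EReal.coe_sub, EReal.coe_le_coe_iff]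
    exact inner_integral_sub_log_le_toReal_klDiv hKL hi hθ
  · simp [logNormalizer, if_neg hθ]

/-- Along the ray nθ, ⟨y, nθ⟩ - ψ_P(nθ) = -log ∫ exp(n⟨z - y, θ⟩) dP(z). The integrand is at most 1
and tends to 0 almost everywhere, so the ray lies in Θ_P and the values tend to infinity. -/
theorem cramerRate_eq_top {P : Measure (E d)} [IsProbabilityMeasure P] {y θ : E d}
    (h : ∀ᵐ z ∂P, (inner ℝ z θ : ℝ) < inner ℝ y θ) : cramerRate P y = ⊤ := by
  set I : ℕ → ℝ := fun n => ∫ z, Real.exp (n * (inner ℝ z θ - inner ℝ y θ)) ∂P with hI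
  have hmeas : ∀ n : ℕ, AEStronglyMeasurable
      (fun z : E d => Real.exp (n * (inner ℝ z θ - inner ℝ y θ))) P := fun n => by
    have : Continuous fun z : E d => Real.exp (n * (inner ℝ z θ - inner ℝ y θ)) := by fun_prop
    exact this.aestronglyMeasurable
  have hbound : ∀ n : ℕ, ∀ᵐ z ∂P, ‖Real.exp (n * (inner ℝ z θ - inner ℝ y θ))‖ ≤ 1 := by
    intro n
    filter_upwards [h] with z hz
    rw [Real.norm_eq_abs, Real.abs_exp, Real.exp_le_one_iff]
    exact mul_nonpos_of_nonneg_of_nonpos n.cast_nonneg (by linarith)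
  have hint : ∀ n : ℕ, Integrable (fun z : E d => Real.exp (n * (inner ℝ z θ - inner ℝ y θ))) P :=
    fun n => Integrable.of_bound (hmeas n) 1 (hbound n)
  have hpos : ∀ n, 0 < I n := fun n => integral_exp_pos (hint n)
  have hlim : Tendsto I atTop (𝓝 0) := by
    have := tendsto_integral_of_dominated_convergence (f := fun _ => (0 : ℝ)) (fun _ => (1 : ℝ))
      hmeas (integrable_const _) hbound ?_
    · simpa using this
    · filter_upwards [h] with z hz
      refine Real.tendsto_exp_atBot.comp ?_
      exact tendsto_natCast_atTop_atTop.atTop_mul_const_of_neg (by linarith)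
  have hlog : Tendsto (fun n => -Real.log (I n)) atTop atTop :=
    tendsto_neg_atBot_atTop.comp (Real.tendsto_log_nhdsGT_zero.comp
      (tendsto_nhdsWithin_iff.2 ⟨hlim, Eventually.of_forall hpos⟩))
  have hfac : ∀ (n : ℕ) (z : E d), Real.exp (inner ℝ z ((n : ℝ) • θ)) =
      Real.exp (n * inner ℝ y θ) * Real.exp (n * (inner ℝ z θ - inner ℝ y θ)) := by
    intro n z
    rw [← Real.exp_add, real_inner_smul_right]
    ring_nf
  have hterm : ∀ n : ℕ, ((-Real.log (I n) : ℝ) : EReal) ≤ cramerRate P y := by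
    intro n
    have hmem : (n : ℝ) • θ ∈ naturalParameters P := by
      simp only [naturalParameters, Set.mem_ofPred_eq, hfac n]
      exact (hint n).const_mul _
    refine le_of_eq_of_le ?_
      (le_iSup (fun x : E d => ((inner ℝ y x : ℝ) : EReal) - logNormalizer P x) ((n : ℝ) • θ))
    rw [logNormalizer, if_pos hmem, ← EReal.coe_sub, EReal.coe_eq_coe_iff]
    simp only [hfac n]
    rw [integral_const_mul, Real.log_mul (Real.exp_pos _).ne' (hpos n).ne', Real.log_exp,
      real_inner_smul_right]
    ring
  refine EReal.eq_top_iff_forall_lt _ |>.2 fun x => ?_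
  obtain ⟨n, hn⟩ := (hlog.eventually_gt_atTop x).exists
  exact (EReal.coe_lt_coe_iff.2 hn).trans_le (hterm n)

theorem SampleSpace.ae_mem_support (S : SampleSpace d) {P : Measure (E d)}
    (hP : P ∈ S.distributions) : ∀ᵐ z ∂P, z ∈ S.support P := by
  cases S with
  | continuous => exact Measure.support_mem_ae
  | discrete Ω hΩ =>
    have h1 : P Ωᶜ = 0 := hP.2 (by
      change Measure.count.restrict Ω Ωᶜ = 0
      rw [Measure.restrict_apply hΩ.measurableSet.compl]
      simp)
    have h2 := (SampleSpace.isLeast_support_discrete Ω hΩ P hP).1.2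
    filter_upwards [mem_ae_iff.2 h1, measure_eq_zero_iff_ae_notMem.1 h2] with z hz1 hz2
    by_contra h
    exact hz2 ⟨by simpa using hz1, h⟩

theorem SampleSpace.convex_convexSupport (S : SampleSpace d) (P : Measure (E d)) :
    Convex ℝ (S.convexSupport P) := (convex_convexHull ℝ _).closure

theorem SampleSpace.ae_mem_convexSupport (S : SampleSpace d) {P : Measure (E d)}
    (hP : P ∈ S.distributions) : ∀ᵐ z ∂P, z ∈ S.convexSupport P :=
  (S.ae_mem_support hP).mono fun _ hz => subset_closure (subset_convexHull ℝ _ hz)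

theorem exists_inner_eq (f : StrongDual ℝ (E d)) : ∃ θ : E d, ∀ z, f z = inner ℝ z θ :=
  ⟨(InnerProductSpace.toDual ℝ (E d)).symm f, fun z => by
    rw [real_inner_comm, InnerProductSpace.toDual_symm_apply]⟩

theorem dom_cramerRate_subset_convexSupport (S : SampleSpace d) {P : Measure (E d)}
    (hP : P ∈ S.distributions) : dom (cramerRate P) ⊆ S.convexSupport P := by
  intro y hy
  by_contra hyC
  have := hP.1
  obtain ⟨f, u, hf, hfy⟩ :=
    geometric_hahn_banach_closed_point (S.convex_convexSupport P) isClosed_closure hyC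
  obtain ⟨θ, hθ⟩ := exists_inner_eq f
  refine (ne_of_lt hy) (cramerRate_eq_top (θ := θ) ?_)
  filter_upwards [S.ae_mem_convexSupport hP] with z hz
  rw [← hθ, ← hθ]
  exact (hf z hz).trans hfy

theorem volume_setOf_inner_eq {θ : E d} (hθ : θ ≠ 0) (y : E d) :
    volume {z : E d | (inner ℝ z θ : ℝ) = inner ℝ y θ} = 0 := by
  let A : AffineSubspace ℝ (E d) := AffineSubspace.mk' y (innerSL ℝ θ : E d →ₗ[ℝ] ℝ).ker
  have hA : (A : Set (E d)) = {z : E d | (inner ℝ z θ : ℝ) = inner ℝ y θ} := by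
    ext z
    simp [A, AffineSubspace.mem_mk', inner_sub_right, sub_eq_zero, real_inner_comm]
  rw [← hA]
  refine Measure.addHaar_affineSubspace _ _ fun htop => ?_
  have h1 : y + θ ∈ (A : Set (E d)) := by simp [htop]
  rw [hA, Set.mem_ofPred_eq, inner_add_left, add_eq_left, inner_self_eq_zero] at h1
  exact hθ h1

theorem SampleSpace.IsMinimal.interior_convexSupport_nonempty {S : SampleSpace d}
    {P : Measure (E d)} (hP : P ∈ S.distributions) (h : S.IsMinimal P) :
    (interior (S.convexSupport P)).Nonempty := by
  have := hP.1
  obtain ⟨z, hz⟩ := (S.ae_mem_convexSupport hP).exists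
  rw [(S.convex_convexSupport P).interior_nonempty_iff_affineSpan_eq_top,
    AffineSubspace.affineSpan_eq_top_iff_vectorSpan_eq_top_of_nonempty ℝ (E d) (E d) ⟨z, hz⟩]
  refine Submodule.eq_top_of_finrank_eq ?_
  rw [finrank_euclideanSpace_fin]
  exact h.2

theorem dom_cramerRate_subset_interior_convexSupport {P : Measure (E d)}
    (hP : P ∈ (SampleSpace.continuous : SampleSpace d).distributions)
    (hmin : (SampleSpace.continuous : SampleSpace d).IsMinimal P) :
    dom (cramerRate P) ⊆ interior ((SampleSpace.continuous : SampleSpace d).convexSupport P) := by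
  intro y hy
  by_contra hyC
  have := hP.1
  have hconv := (SampleSpace.continuous : SampleSpace d).convex_convexSupport P
  have hne := hmin.interior_convexSupport_nonempty hP
  obtain ⟨f, hf⟩ := geometric_hahn_banach_open_point hconv.interior isOpen_interior hyC
  obtain ⟨θ, hθ⟩ := exists_inner_eq f
  have hθ0 : θ ≠ 0 := by
    rintro rfl
    obtain ⟨x, hx⟩ := hne
    simpa [hθ] using hf x hx
  -- Separation is strict only on the interior; the weak inequality passes to the closure, which
  -- contains the convex support.
  have hle : ∀ z ∈ closure (interior ((SampleSpace.continuous : SampleSpace d).convexSupport P)),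
      f z ≤ f y :=
    fun z hz => closure_minimal (t := {z | f z ≤ f y}) (fun z hz => (hf z hz).le)
      (isClosed_le f.continuous continuous_const) hz
  refine (ne_of_lt hy) (cramerRate_eq_top (θ := θ) ?_)
  have hnull : P {z : E d | (inner ℝ z θ : ℝ) = inner ℝ y θ} = 0 :=
    hP.2 (volume_setOf_inner_eq hθ0 y)
  filter_upwards [SampleSpace.ae_mem_convexSupport _ hP, measure_eq_zero_iff_ae_notMem.1 hnull]
    with z hz hz'
  refine lt_of_le_of_ne ?_ hz'
  rw [← hθ, ← hθ]
  refine hle z ?_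
  rw [hconv.closure_interior_eq_closure_of_nonempty_interior hne]
  exact subset_closure hz

theorem SampleSpace.measure_singleton_ne_zero (S : SampleSpace d) {P : Measure (E d)}
    (hP : P ∈ S.distributions) (hc : (S.support P).Countable) {y : E d} (hy : y ∈ S.support P) :
    P {y} ≠ 0 := by
  cases S with
  | discrete Ω hΩ => exact hy.2
  | continuous =>
    have := hP.1
    -- A countable set is Lebesgue null unless d = 0, where a singleton is the whole space.
    rcases subsingleton_or_nontrivial (E d) with hsub | hnt
    · have : ({y} : Set (E d)) = Set.univ := Set.eq_univ_of_forall fun z => Subsingleton.elim z y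
      rw [this]
      simp
    · have h0 : P (SampleSpace.continuous.support P) = 0 :=
        hP.2 (hc.measure_zero (volume : Measure (E d)))
      obtain ⟨z, hz, hz'⟩ := ((SampleSpace.ae_mem_support _ hP).and
        (measure_eq_zero_iff_ae_notMem.1 h0)).exists
      exact absurd hz hz'

/-! ### The two cases -/

theorem dom_eq_convexSupport_of_countable (S : SampleSpace d) {P : Measure (E d)}
    (hP : P ∈ S.distributions) (hc : (S.support P).Countable)
    (hcl : IsClosed (convexHull ℝ (S.support P))) :
    dom (S.memFunction P) = S.convexSupport P ∧ dom (cramerRate P) = S.convexSupport P := by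
  have := hP.1
  have h1 : S.convexSupport P ⊆ dom (S.memFunction P) := by
    rw [SampleSpace.convexSupport, hcl.closure_eq]
    refine (convexHull_min (fun y hy => ?_) (convex_boundedDensityMeans P)).trans
      (boundedDensityMeans_subset_dom_memFunction S hP)
    exact mem_boundedDensityMeans_of_atom (S.measure_singleton_ne_zero hP hc hy)
  have h2 := dom_memFunction_subset_dom_cramerRate S hP
  have h3 := dom_cramerRate_subset_convexSupport S hP
  exact ⟨(h2.trans h3).antisymm h1, h3.antisymm (h1.trans h2)⟩

theorem dom_eq_interior_convexSupport_of_not_countable (S : SampleSpace d) {P : Measure (E d)}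
    (hP : P ∈ S.distributions) (hmin : S.IsMinimal P) (hc : ¬ (S.support P).Countable) :
    dom (S.memFunction P) = interior (S.convexSupport P) ∧
      dom (cramerRate P) = interior (S.convexSupport P) := by
  cases S with
  -- A countable Ω has countable support, so only the Lebesgue case remains.
  | discrete Ω hΩ => exact absurd (hΩ.mono fun y hy => hy.1) hc
  | continuous =>
    have := hP.1
    have hM := convex_boundedDensityMeans P
    have h0 : (SampleSpace.continuous : SampleSpace d).convexSupport P ⊆
        closure (boundedDensityMeans P) :=
      closure_minimal (convexHull_min (support_subset_closure_boundedDensityMeans P) hM.closure)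
        isClosed_closure
    have h1 := ((interior_mono h0).trans hM.interior_closure_subset).trans
      (boundedDensityMeans_subset_dom_memFunction _ hP)
    have h2 := dom_memFunction_subset_dom_cramerRate _ hP
    have h3 := dom_cramerRate_subset_interior_convexSupport hP hmin
    exact ⟨(h2.trans h3).antisymm h1, h3.antisymm (h1.trans h2)⟩

end MaxEntMean

theorem mainTheorem3 {d : ℕ} (S : MaxEntMean.SampleSpace d)
    (P : MeasureTheory.Measure (MaxEntMean.E d)) (hP : P ∈ S.distributions)
    (hmin : S.IsMinimal P) (hsteep : MaxEntMean.IsSteep P)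
    (hzero : (0 : MaxEntMean.E d) ∈ interior (MaxEntMean.naturalParameters P)) :
    ((S.support P).Countable → IsClosed (convexHull ℝ (S.support P)) →
      MaxEntMean.dom (S.memFunction P) = S.convexSupport P ∧
      MaxEntMean.dom (MaxEntMean.cramerRate P) = S.convexSupport P) ∧
    ((S.support P).Finite →
      MaxEntMean.dom (S.memFunction P) = S.convexSupport P ∧
      MaxEntMean.dom (MaxEntMean.cramerRate P) = S.convexSupport P) ∧
    (¬ (S.support P).Countable →
      MaxEntMean.dom (S.memFunction P) = interior (S.convexSupport P) ∧
      MaxEntMean.dom (MaxEntMean.cramerRate P) = interior (S.convexSupport P)) := by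
  exact ⟨MaxEntMean.dom_eq_convexSupport_of_countable S hP,
    fun hf => MaxEntMean.dom_eq_convexSupport_of_countable S hP hf.countable
      (hf.isClosed_convexHull ℝ),
    MaxEntMean.dom_eq_interior_convexSupport_of_not_countable S hP hmin⟩
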